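/- Let $G$ be a discrete group and let $\mathcal B=(B_g)_{g\in G}$ be a Fell bundle over $G$. Let $C_c(\mathcal B)$ be the space of finitely supported sections of $\mathcal B$, and let $\ell^2(\mathcal B)$ be the right Hilbert $B_e$-module obtained by completing $C_c(\mathcal B)$ for the inner product $\langle f,k\rangle=\sum_{h\in G}f(h)^*k(h)$. For $g\in G$ and $b\in B_g$ let $\lambda_g(b)$ be the adjointable operator on $\ell^2(\mathcal B)$ determined by $(\lambda_g(b)f)(h)=b\,f(g^{-1}h)$ for $f\in C_c(\mathcal B)$ and $h\in G$. Let $C_r^*(\mathcal B)$ be the $C^*$-subalgebra of $\mathcal L_{B_e}(\ell^2(\mathcal B))$ generated by all the $\lambda_g(b)$, and for $f\in C_c(\mathcal B)$ put $\iota(f)=\sum_{g}\lambda_g(f(g))$ and $\|f\|_r=\|\iota(f)\|$. A $\mathcal B$-bundle map, that is, a family $T=(T_g)_{g\in G}$ of bounded linear maps $T_g:B_g\to B_g$, is called reduced if the linear map $\phi_T$ on $C_c(\mathcal B)$ given by $\phi_T(f)(g)=T_g(f(g))$ is bounded for $\|\cdot\|_r$; in that case $M_T:C_r^*(\mathcal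 B)\to C_r^*(\mathcal B)$ denotes the unique bounded linear map such that $M_T(\lambda_g(b))=\lambda_g(T_g(b))$ for all $g\in G$ and $b\in B_g$. Let $v$ be a uniformly bounded representation of $G$ into the invertible bounded linear operators on a complex Hilbert space $\mathcal H$, and set $K=\sup_{g\in G}\|v(g)\|<\infty$. Let $\xi_1,\xi_2\in\mathcal H$ and define $\varphi:G\to\mathbb C$ by $\varphi(g)=\langle \xi_1,v(g)\xi_2\rangle$, the inner product being linear in the second variable. Let $T^\varphi$ be the $\mathcal B$-bundle map given by $T^\varphi_g(b)=\varphi(g)b$ for $g\in G$ and $b\in B_g$. Then $T^\varphi$ is reduced, and the associated map $M_{T^\varphi}:C_r^*(\mathcal B)\to C_r^*(\mathcal B)$ is completely bounded, with $$\|M_{T^\varphi}\|_{\mathrm{cb}}\le K^2\,\|\xi_1\|\,\|\xi_2\|.$$ -/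

import Mathlib

noncomputable section

open Filter Topology

set_option linter.unusedSectionVars false

/-! ### Adjointable operators on a Hilbert C⋆-module -/

section Adjointable

variable (A E : Type*) [NonUnitalCStarAlgebra A] [PartialOrder A]
  [NormedAddCommGroup E] [NormedSpace ℂ E] [SMul A E] [CStarModule A E]

/-- The adjointable operators on a Hilbert `A`-module `E`, as a subalgebra of the bounded
operators on `E` (on a complete module, a map that has an adjoint is automatically linear and
bounded, and so is its adjoint). -/
def adjointableSubalgebra : Subalgebra ℂ (E →L[ℂ] E) where
  carrier := {T | ∃ S : E →L[ℂ] E, ∀ x y : E, inner A (T x) y = inner A x (S y)}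
  mul_mem' := by
    rintro T₁ T₂ ⟨S₁, h₁⟩ ⟨S₂, h₂⟩
    exact ⟨S₂ * S₁, fun x y => by simp [h₁, h₂]⟩
  add_mem' := by
    rintro T₁ T₂ ⟨S₁, h₁⟩ ⟨S₂, h₂⟩
    exact ⟨S₁ + S₂, fun x y => by simp [h₁, h₂]⟩
  algebraMap_mem' c := ⟨algebraMap ℂ _ (star c), fun x y => by
    simp [Algebra.algebraMap_eq_smul_one]⟩

/-- The C⋆-algebra `ℒ_A(E)` of adjointable operators on a Hilbert `A`-module `E`, with the operator
norm. -/
def Adjointable : Type _ := adjointableSubalgebra A E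

namespace Adjointable

instance : NormedRing (Adjointable A E) := inferInstanceAs (NormedRing (adjointableSubalgebra A E))

instance : NormedAlgebra ℂ (Adjointable A E) :=
  inferInstanceAs (NormedAlgebra ℂ (adjointableSubalgebra A E))

variable {A E}

/-- The bounded operator underlying an adjointable operator. -/
def toCLM (T : Adjointable A E) : E →L[ℂ] E := Subtype.val T

theorem toCLM_injective : Function.Injective (toCLM : Adjointable A E → E →L[ℂ] E) :=
  Subtype.val_injective

theorem norm_def (T : Adjointable A E) : ‖T‖ = ‖T.toCLM‖ := rfl

@[simp] theorem toCLM_mul (T S : Adjointable A E) (x : E) :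
    (T * S).toCLM x = T.toCLM (S.toCLM x) := rfl

@[simp] theorem toCLM_add (T S : Adjointable A E) (x : E) :
    (T + S).toCLM x = T.toCLM x + S.toCLM x := rfl

@[simp] theorem toCLM_smul (c : ℂ) (T : Adjointable A E) (x : E) :
    (c • T).toCLM x = c • T.toCLM x := rfl

theorem exists_adjoint (T : Adjointable A E) :
    ∃ S : E →L[ℂ] E, ∀ x y : E, inner A (T.toCLM x) y = inner A x (S y) := Subtype.property T

theorem ext_inner {x y : E} (h : ∀ z : E, inner A z x = inner A z y) : x = y := by
  have h0 : inner A (x - y) (x - y) = (0 : A) := by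
    rw [CStarModule.inner_sub_right, h, sub_self]
  exact sub_eq_zero.mp (CStarModule.inner_self.mp h0)

/-- The adjoint of an adjointable operator. -/
instance : Star (Adjointable A E) where
  star T := ⟨T.exists_adjoint.choose, T.toCLM, fun x y => by
    rw [← CStarModule.star_inner, ← T.exists_adjoint.choose_spec, CStarModule.star_inner]⟩

/-- The adjoint is the one with respect to the `A`-valued inner product. -/
theorem inner_star_right (T : Adjointable A E) (x y : E) :
    inner A x ((star T).toCLM y) = inner A (T.toCLM x) y :=
  (T.exists_adjoint.choose_spec x y).symm

theorem inner_star_left (T : Adjointable A E) (x y : E) :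
    inner A ((star T).toCLM x) y = inner A x (T.toCLM y) := by
  rw [← CStarModule.star_inner, inner_star_right, CStarModule.star_inner]

theorem star_eq_of_inner {T S : Adjointable A E}
    (h : ∀ x y : E, inner A (T.toCLM x) y = inner A x (S.toCLM y)) : star T = S := by
  refine toCLM_injective (ContinuousLinearMap.ext fun y => ext_inner (A := A) fun x => ?_)
  rw [inner_star_right, h]

instance : StarRing (Adjointable A E) where
  star_involutive T := star_eq_of_inner (inner_star_left T)
  star_mul T S := star_eq_of_inner fun x y => by
    simp only [toCLM_mul, inner_star_right]
  star_add T S := star_eq_of_inner fun x y => by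
    simp only [toCLM_add, CStarModule.inner_add_left, CStarModule.inner_add_right,
      inner_star_right]

instance : StarModule ℂ (Adjointable A E) where
  star_smul c T := star_eq_of_inner fun x y => by
    rw [toCLM_smul, toCLM_smul, CStarModule.inner_smul_right_complex, inner_star_right,
      CStarModule.inner_smul_left_complex]

variable [StarOrderedRing A]

instance : CStarRing (Adjointable A E) := .of_le_norm_mul_star_self fun T => by
  have key : ∀ S : Adjointable A E, ‖S‖ ^ 2 ≤ ‖star S * S‖ := by
    intro S
    have hb : ‖S‖ ≤ √‖star S * S‖ := by
      refine ContinuousLinearMap.opNorm_le_bound _ (Real.sqrt_nonneg _) fun x => ?_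
      refine abs_le_of_sq_le_sq' (b := √‖star S * S‖ * ‖x‖) ?_ (by positivity) |>.2
      change ‖S.toCLM x‖ ^ 2 ≤ _
      rw [mul_pow, Real.sq_sqrt (norm_nonneg _), CStarModule.norm_sq_eq A, ← inner_star_right]
      calc _ ≤ ‖x‖ * ‖(star S * S).toCLM x‖ := CStarModule.norm_inner_le E
        _ ≤ ‖x‖ * (‖star S * S‖ * ‖x‖) := by
          gcongr; exact ContinuousLinearMap.le_opNorm _ _
        _ = _ := by ring
    calc ‖S‖ ^ 2 ≤ √‖star S * S‖ ^ 2 := by gcongr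
      _ = _ := Real.sq_sqrt (norm_nonneg _)
  have hle : ∀ S : Adjointable A E, ‖S‖ ≤ ‖star S‖ := by
    intro S
    rcases (norm_nonneg S).eq_or_lt with h | h
    · rw [← h]; exact norm_nonneg _
    · refine le_of_mul_le_mul_right ?_ h
      calc ‖S‖ * ‖S‖ = ‖S‖ ^ 2 := by ring
        _ ≤ _ := key S
        _ ≤ _ := norm_mul_le _ _
  have h1 := key (star T)
  rw [star_star] at h1
  nlinarith [hle T, norm_nonneg T]

instance [CompleteSpace E] : CompleteSpace (Adjointable A E) := by
  refine Metric.complete_of_cauchySeq_tendsto fun w hw => ?_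
  have hval : UniformContinuous (toCLM : Adjointable A E → E →L[ℂ] E) :=
    uniformContinuous_subtype_val
  obtain ⟨T, hT⟩ := cauchySeq_tendsto_of_complete (hval.comp_cauchySeq hw)
  obtain ⟨S, hS⟩ := cauchySeq_tendsto_of_complete
    ((hval.comp (star_isometry (E := Adjointable A E)).uniformContinuous).comp_cauchySeq hw)
  have hTS : ∀ x y : E, inner A (T x) y = inner A x (S y) := by
    intro x y
    have h1 : Tendsto (fun n => inner A ((w n).toCLM x) y) atTop (𝓝 (inner A (T x) y)) :=
      (((CStarModule.continuous_inner (A := A) (E := E)).comp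
        (Continuous.prodMk_left y)).tendsto (T x)).comp
        (((ContinuousLinearMap.apply ℂ E x).continuous.tendsto T).comp hT)
    have h2 : Tendsto (fun n => inner A x ((star (w n)).toCLM y)) atTop (𝓝 (inner A x (S y))) :=
      (((CStarModule.continuous_inner (A := A) (E := E)).comp
        (Continuous.prodMk_right x)).tendsto (S y)).comp
        (((ContinuousLinearMap.apply ℂ E y).continuous.tendsto S).comp hS)
    exact tendsto_nhds_unique h1 (h2.congr fun n => inner_star_right (w n) x y)
  exact ⟨⟨T, S, hTS⟩, tendsto_subtype_rng.mpr hT⟩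

instance [CompleteSpace E] : CStarAlgebra (Adjointable A E) where

end Adjointable
end Adjointable

/-! ### Completion of a pre-Hilbert C⋆-module -/

section Completion

open UniformSpace

variable {A E : Type*} [NonUnitalCStarAlgebra A] [PartialOrder A] [StarOrderedRing A]
  [NormedAddCommGroup E] [NormedSpace ℂ E] [SMul A E] [CStarModule A E]

theorem CStarModule.uniformContinuousConstSMul : UniformContinuousConstSMul A E where
  uniformContinuous_const_smul a := by
    refine (LipschitzWith.of_dist_le_mul (K := ‖a‖₊) fun x y => ?_).uniformContinuous
    have h : a • x - a • y = a • (x - y) := Adjointable.ext_inner (A := A) fun z => by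
      simp [mul_sub]
    rw [dist_eq_norm, dist_eq_norm, h]
    refine abs_le_of_sq_le_sq' (b := ‖a‖ * ‖x - y‖) ?_ (by positivity) |>.2
    rw [CStarModule.norm_sq_eq A, CStarModule.inner_op_smul_left, CStarModule.inner_op_smul_right]
    calc _ ≤ ‖a‖ * ‖inner A (x - y) (x - y)‖ * ‖star a‖ := norm_mul₃_le
      _ = _ := by rw [← CStarModule.norm_sq_eq A, norm_star]; ring

variable [UniformContinuousConstSMul A E]

theorem CStarModule.completion_inner_coe (x y : E) :
    inner A (x : Completion E) (y : Completion E) = inner A x y :=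
  (Completion.isDenseInducing_coe.prodMap Completion.isDenseInducing_coe).extend_eq
    (CStarModule.continuous_inner (A := A) (E := E)) (x, y)

theorem CStarModule.continuous_completion_inner :
    Continuous fun p : Completion E × Completion E => inner A p.1 p.2 := by
  let inner' : E →+ E →+ A :=
    { toFun := fun x => (CStarModule.innerₛₗ x : E →ₗ[ℂ] A).toAddMonoidHom
      map_zero' := by ext x; exact CStarModule.inner_zero_left
      map_add' := fun x y => by ext z; exact CStarModule.inner_add_left }
  have : Continuous fun p : E × E => inner' p.1 p.2 := CStarModule.continuous_inner
  change Continuous (((Completion.isDenseInducing_toCompl E).prodMap (Completion.isDenseInducing_toCompl E)).extend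
    fun p : E × E => inner' p.1 p.2)
  exact (Completion.isDenseInducing_toCompl E).extend_Z_bilin (Completion.isDenseInducing_toCompl E) this

theorem Continuous.cstar_inner {X : Type*} [TopologicalSpace X] {f g : X → Completion E}
    (hf : Continuous f) (hg : Continuous g) : Continuous fun t => Inner.inner A (f t) (g t) :=
  (CStarModule.continuous_completion_inner (A := A) (E := E)).comp (hf.prodMk hg)

theorem CStarModule.completion_norm_eq (x : Completion E) : ‖x‖ = √‖inner A x x‖ :=
  Completion.induction_on x
    (isClosed_eq continuous_norm (continuous_id.cstar_inner continuous_id).norm.sqrt)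
    fun a => by rw [CStarModule.completion_inner_coe, Completion.norm_coe,
      CStarModule.norm_eq_sqrt_norm_inner_self (A := A)]

/-- The completion of a pre-Hilbert `A`-module is a Hilbert `A`-module; the inner product and the
action of `A` are the continuous extensions. -/
instance CStarModule.instCompletion : CStarModule A (Completion E) where
  inner_add_right {x y z} := Completion.induction_on₃ x y z
    (isClosed_eq
      (continuous_fst.cstar_inner (continuous_snd.fst.add continuous_snd.snd))
      ((continuous_fst.cstar_inner continuous_snd.fst).add
        (continuous_fst.cstar_inner continuous_snd.snd)))
    fun a b c => by
      simp only [← Completion.coe_add, CStarModule.completion_inner_coe,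
        CStarModule.inner_add_right]
  inner_self_nonneg {x} := Completion.induction_on x
    (isClosed_le continuous_const (continuous_id.cstar_inner continuous_id))
    fun a => by rw [CStarModule.completion_inner_coe]; exact CStarModule.inner_self_nonneg
  inner_self {x} := by
    rw [← norm_eq_zero, ← norm_eq_zero (a := x), CStarModule.completion_norm_eq (A := A),
      Real.sqrt_eq_zero (norm_nonneg _)]
  inner_op_smul_right {a x y} := Completion.induction_on₂ x y
    (isClosed_eq (continuous_fst.cstar_inner (continuous_snd.const_smul a))
      (continuous_const.mul (continuous_fst.cstar_inner continuous_snd)))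
    fun b c => by
      rw [← Completion.coe_smul, CStarModule.completion_inner_coe,
        CStarModule.completion_inner_coe, CStarModule.inner_op_smul_right]
  inner_smul_right_complex {z x y} := Completion.induction_on₂ x y
    (isClosed_eq (continuous_fst.cstar_inner (continuous_snd.const_smul z))
      ((continuous_fst.cstar_inner continuous_snd).const_smul z))
    fun b c => by
      rw [← Completion.coe_smul, CStarModule.completion_inner_coe,
        CStarModule.completion_inner_coe, CStarModule.inner_smul_right_complex]
  star_inner x y := Completion.induction_on₂ x y
    (isClosed_eq (continuous_fst.cstar_inner continuous_snd).star
      (continuous_snd.cstar_inner continuous_fst))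
    fun b c => by
      rw [CStarModule.completion_inner_coe, CStarModule.completion_inner_coe,
        CStarModule.star_inner]
  norm_eq_sqrt_norm_inner_self x := CStarModule.completion_norm_eq x

end Completion

/-! ### Fell bundles over discrete groups -/

universe u v

/-- A Fell bundle over the discrete group `G`. The multiplication `A_g × A_h → A_{gh}` and the
involution `A_g → A_{g⁻¹}` are given with their target fibre named by an equation in `G`
(`mul (h : g * h = k) : A_g → A_h → A_k` and `adj (h : g⁻¹ = k) : A_g → A_k`), so that associativity
and the other laws, which compare elements of equal but not definitionally equal fibres, can be
written as plain equations. In the last field, positivity of `a⋆a` in the C⋆-algebra `A_e` is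
expressed by `a⋆a = b⋆b` for some `b ∈ A_e`. -/
structure FellBundle (G : Type u) [Group G] where
  /-- The fibres, which are complex Banach spaces. -/
  fibre : G → Type v
  [normedAddCommGroup : ∀ g, NormedAddCommGroup (fibre g)]
  [normedSpace : ∀ g, NormedSpace ℂ (fibre g)]
  [completeSpace : ∀ g, CompleteSpace (fibre g)]
  /-- The multiplication `A_g × A_h → A_{gh}`. -/
  mul : ∀ {g h k : G}, g * h = k → fibre g → fibre h → fibre k
  /-- The involution `A_g → A_{g⁻¹}`. -/
  adj : ∀ {g k : G}, g⁻¹ = k → fibre g → fibre k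
  mul_add : ∀ {g h k : G} (p : g * h = k) (a : fibre g) (b c : fibre h),
    mul p a (b + c) = mul p a b + mul p a c
  add_mul : ∀ {g h k : G} (p : g * h = k) (a b : fibre g) (c : fibre h),
    mul p (a + b) c = mul p a c + mul p b c
  mul_smul : ∀ {g h k : G} (p : g * h = k) (z : ℂ) (a : fibre g) (b : fibre h),
    mul p a (z • b) = z • mul p a b
  smul_mul : ∀ {g h k : G} (p : g * h = k) (z : ℂ) (a : fibre g) (b : fibre h),
    mul p (z • a) b = z • mul p a b
  mul_assoc : ∀ {g h k gh hk m : G} (p : g * h = gh) (q : gh * k = m) (r : h * k = hk)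
    (s : g * hk = m) (a : fibre g) (b : fibre h) (c : fibre k),
    mul q (mul p a b) c = mul s a (mul r b c)
  norm_mul_le : ∀ {g h k : G} (p : g * h = k) (a : fibre g) (b : fibre h),
    ‖mul p a b‖ ≤ ‖a‖ * ‖b‖
  adj_add : ∀ {g k : G} (p : g⁻¹ = k) (a b : fibre g), adj p (a + b) = adj p a + adj p b
  adj_smul : ∀ {g k : G} (p : g⁻¹ = k) (z : ℂ) (a : fibre g), adj p (z • a) = star z • adj p a
  adj_adj : ∀ {g k : G} (p : g⁻¹ = k) (q : k⁻¹ = g) (a : fibre g), adj q (adj p a) = a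
  adj_mul : ∀ {g h k g' h' k' : G} (p : g * h = k) (q : k⁻¹ = k') (r : g⁻¹ = g') (s : h⁻¹ = h')
    (t : h' * g' = k') (a : fibre g) (b : fibre h),
    adj q (mul p a b) = mul t (adj s b) (adj r a)
  norm_adj : ∀ {g k : G} (p : g⁻¹ = k) (a : fibre g), ‖adj p a‖ = ‖a‖
  norm_adj_mul_self : ∀ {g k : G} (p : g⁻¹ = k) (q : k * g = 1) (a : fibre g),
    ‖mul q (adj p a) a‖ = ‖a‖ ^ 2
  adj_mul_self_nonneg : ∀ {g k : G} (p : g⁻¹ = k) (q : k * g = 1) (a : fibre g),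
    ∃ b : fibre 1, mul q (adj p a) a = mul (one_mul 1) (adj inv_one b) b

namespace FellBundle

variable {G : Type u} [Group G] (B : FellBundle.{u, v} G)

attribute [instance] normedAddCommGroup normedSpace completeSpace

/-- The unit fibre of a Fell bundle is a C⋆-algebra. -/
instance instUnitFibre : NonUnitalCStarAlgebra (B.fibre 1) where
  __ := B.normedAddCommGroup 1
  __ := B.normedSpace 1
  complete := (B.completeSpace 1).complete
  mul a b := B.mul (one_mul 1) a b
  left_distrib a b c := B.mul_add _ a b c
  right_distrib a b c := B.add_mul _ a b c
  zero_mul a := show B.mul (one_mul 1) 0 a = 0 by simpa using B.smul_mul (one_mul 1) 0 0 a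
  mul_zero a := show B.mul (one_mul 1) a 0 = 0 by simpa using B.mul_smul (one_mul 1) 0 a 0
  mul_assoc a b c := B.mul_assoc _ _ _ _ a b c
  norm_mul_le a b := B.norm_mul_le _ a b
  star a := B.adj inv_one a
  star_involutive a := B.adj_adj _ _ a
  star_mul a b := B.adj_mul _ _ _ _ _ a b
  star_add a b := B.adj_add _ a b
  norm_mul_self_le a := by
    rw [← sq]; exact (B.norm_adj_mul_self inv_one (one_mul 1) a).ge
  smul_assoc z a b := B.smul_mul _ z a b
  smul_comm z a b := (B.mul_smul _ z a b).symm
  star_smul z a := B.adj_smul _ z a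

/-- The order of the C⋆-algebra `A_e`. -/
instance : PartialOrder (B.fibre 1) := CStarAlgebra.spectralOrder _

instance : StarOrderedRing (B.fibre 1) := CStarAlgebra.spectralOrderedRing _

variable {B}

theorem mul_def (a b : B.fibre 1) (p : (1 : G) * 1 = 1) : B.mul p a b = a * b := rfl

theorem adj_def (a : B.fibre 1) (p : (1 : G)⁻¹ = 1) : B.adj p a = star a := rfl

@[simp] theorem mul_zero {g h k : G} (p : g * h = k) (a : B.fibre g) :
    B.mul p a (0 : B.fibre h) = 0 := by simpa using B.mul_smul p 0 a 0

@[simp] theorem zero_mul {g h k : G} (p : g * h = k) (a : B.fibre h) :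
    B.mul p (0 : B.fibre g) a = 0 := by simpa using B.smul_mul p 0 0 a

@[simp] theorem adj_zero {g k : G} (p : g⁻¹ = k) : B.adj p (0 : B.fibre g) = 0 := by
  simpa using B.adj_smul p 0 0

/-- `⟨a, b⟩ = a⋆ b ∈ A_e` for `a, b ∈ A_g`. -/
def fibreInner {g : G} (a b : B.fibre g) : B.fibre 1 :=
  B.mul (inv_mul_cancel g) (B.adj rfl a) b

@[simp] theorem fibreInner_zero_right {g : G} (a : B.fibre g) : fibreInner a 0 = 0 := mul_zero _ _

@[simp] theorem fibreInner_zero_left {g : G} (a : B.fibre g) : fibreInner 0 a = 0 := by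
  simp [fibreInner]

theorem fibreInner_add_right {g : G} (a b c : B.fibre g) :
    fibreInner a (b + c) = fibreInner a b + fibreInner a c := B.mul_add _ _ _ _

theorem fibreInner_smul_right {g : G} (z : ℂ) (a b : B.fibre g) :
    fibreInner a (z • b) = z • fibreInner a b := B.mul_smul _ _ _ _

theorem star_fibreInner {g : G} (a b : B.fibre g) : star (fibreInner a b) = fibreInner b a := by
  change B.adj inv_one (B.mul _ _ _) = _
  rw [B.adj_mul _ _ (inv_inv g) rfl (inv_mul_cancel g), B.adj_adj]
  rfl

theorem fibreInner_mul_right {g : G} (a b : B.fibre g) (c : B.fibre 1) :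
    fibreInner a (B.mul (mul_one g) b c) = fibreInner a b * c := by
  rw [← mul_def _ _ (one_mul 1)]
  exact (B.mul_assoc _ _ _ _ _ _ _).symm

theorem fibreInner_self_nonneg {g : G} (a : B.fibre g) : 0 ≤ fibreInner a a := by
  obtain ⟨b, hb⟩ := B.adj_mul_self_nonneg rfl (inv_mul_cancel g) a
  rw [fibreInner, hb]
  exact star_mul_self_nonneg b

theorem norm_fibreInner_self {g : G} (a : B.fibre g) : ‖fibreInner a a‖ = ‖a‖ ^ 2 :=
  B.norm_adj_mul_self _ _ _

theorem fibreInner_self_eq_zero {g : G} {a : B.fibre g} : fibreInner a a = 0 ↔ a = 0 := by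
  rw [← norm_eq_zero, norm_fibreInner_self]; simp

/-- `⟨a b, c⟩ = ⟨b, a⋆ c⟩` for `a ∈ A_g`, `b ∈ A_h`, `c ∈ A_{gh}`. -/
theorem fibreInner_mul_left {g h k g' : G} (p : g * h = k) (q : g' * k = h) (r : g⁻¹ = g')
    (a : B.fibre g) (b : B.fibre h) (c : B.fibre k) :
    fibreInner (B.mul p a b) c = fibreInner b (B.mul q (B.adj r a) c) := by
  subst r p
  rw [fibreInner, B.adj_mul _ rfl rfl rfl (mul_inv_rev g h).symm, fibreInner]
  exact B.mul_assoc _ _ _ _ _ _ _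

/-! ### Finitely supported sections -/

variable (B)

/-- The space `C_c(A)` of finitely supported sections of a Fell bundle. -/
def Section : Type max u v := Π₀ g, B.fibre g

namespace Section

instance : AddCommGroup B.Section := inferInstanceAs (AddCommGroup (Π₀ g, B.fibre g))
instance : Module ℂ B.Section := inferInstanceAs (Module ℂ (Π₀ g, B.fibre g))
instance : DFunLike B.Section G B.fibre := inferInstanceAs (DFunLike (Π₀ g, B.fibre g) G B.fibre)

variable {B}

@[ext] theorem ext {f k : B.Section} (h : ∀ g, f g = k g) : f = k := DFunLike.ext _ _ h

@[simp] theorem zero_apply (g : G) : (0 : B.Section) g = 0 := rfl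
@[simp] theorem add_apply (f k : B.Section) (g : G) : (f + k) g = f g + k g := rfl
@[simp] theorem smul_apply (z : ℂ) (f : B.Section) (g : G) : (z • f) g = z • f g := rfl

open Classical in
/-- The support of a section. -/
def support (f : B.Section) : Finset G := DFinsupp.support f

theorem notMem_support {f : B.Section} {g : G} : g ∉ f.support ↔ f g = 0 := by
  classical
  exact DFinsupp.notMem_support_iff

open Classical in
/-- The section `j_g(a)` supported at `g` with value `a`. -/
def single (g : G) : B.fibre g →ₗ[ℂ] B.Section := DFinsupp.lsingle g

@[simp] theorem single_same (g : G) (a : B.fibre g) : single g a g = a := by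
  classical
  exact DFinsupp.single_eq_same

theorem single_ne {g h : G} (a : B.fibre g) (hgh : h ≠ g) : single g a h = 0 := by
  classical
  exact DFinsupp.single_eq_of_ne hgh

/-- The right action of the unit fibre on `C_c(A)`, defined pointwise, written as an action of the
opposite algebra. -/
instance : SMul (B.fibre 1)ᵐᵒᵖ B.Section where
  smul a f := DFinsupp.mapRange (fun g x => B.mul (mul_one g) x a.unop) (fun _ => zero_mul _ _) f

@[simp] theorem op_smul_apply (a : (B.fibre 1)ᵐᵒᵖ) (f : B.Section) (g : G) :
    (a • f) g = B.mul (mul_one g) (f g) a.unop := rfl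

/-- The `A_e`-valued inner product `⟨f, k⟩ = ∑ₕ f(h)⋆ k(h)` on `C_c(A)`. -/
def innerₑ (f k : B.Section) : B.fibre 1 := ∑ h ∈ k.support, fibreInner (f h) (k h)

theorem innerₑ_eq_sum_right {f k : B.Section} {s : Finset G} (hs : ∀ g ∉ s, k g = 0) :
    innerₑ f k = ∑ h ∈ s, fibreInner (f h) (k h) := by
  refine Finset.sum_subset (fun g hg => ?_) fun g _ hg => ?_
  · by_contra h
    exact notMem_support.mpr (hs g h) hg
  · rw [notMem_support.mp hg, fibreInner_zero_right]

theorem star_innerₑ (f k : B.Section) : star (innerₑ f k) = innerₑ k f := by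
  classical
  rw [innerₑ_eq_sum_right (s := f.support ∪ k.support),
    innerₑ_eq_sum_right (s := f.support ∪ k.support), star_sum]
  · exact Finset.sum_congr rfl fun g _ => star_fibreInner _ _
  · exact fun g hg => notMem_support.mp fun h => hg (Finset.mem_union_left _ h)
  · exact fun g hg => notMem_support.mp fun h => hg (Finset.mem_union_right _ h)

theorem innerₑ_eq_sum_left {f k : B.Section} {s : Finset G} (hs : ∀ g ∉ s, f g = 0) :
    innerₑ f k = ∑ h ∈ s, fibreInner (f h) (k h) := by
  rw [← star_innerₑ, innerₑ_eq_sum_right hs, star_sum]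
  exact Finset.sum_congr rfl fun g _ => star_fibreInner _ _

/-- `C_c(A)` is a right pre-Hilbert `A_e`-module. (Mathlib's Hilbert C⋆-modules carry an action of
the algebra on the left with `⟨x, a • y⟩ = a ⟨x, y⟩`, so that a right Hilbert `A_e`-module, in
which `⟨x, y a⟩ = ⟨x, y⟩ a`, is a Hilbert C⋆-module over the opposite C⋆-algebra.) -/
instance : Inner (B.fibre 1)ᵐᵒᵖ B.Section where
  inner f k := MulOpposite.op (innerₑ f k)

theorem inner_def (f k : B.Section) :
    inner (B.fibre 1)ᵐᵒᵖ f k = MulOpposite.op (innerₑ f k) := rfl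

/-- The norm `‖f‖ = ‖⟨f, f⟩‖^{1/2}` on `C_c(A)`. -/
instance instNorm : Norm B.Section := CStarModule.norm (B.fibre 1)ᵐᵒᵖ

theorem innerₑ_add_right (f k l : B.Section) : innerₑ f (k + l) = innerₑ f k + innerₑ f l := by
  rw [innerₑ_eq_sum_left fun g => notMem_support.mp, innerₑ_eq_sum_left fun g => notMem_support.mp,
    innerₑ_eq_sum_left fun g => notMem_support.mp, ← Finset.sum_add_distrib]
  exact Finset.sum_congr rfl fun g _ => fibreInner_add_right _ _ _

instance : CStarModule (B.fibre 1)ᵐᵒᵖ B.Section where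
  inner_add_right {f k l} := congrArg MulOpposite.op (innerₑ_add_right f k l)
  inner_self_nonneg {f} := by
    change (0 : B.fibre 1) ≤ innerₑ f f
    exact Finset.sum_nonneg fun g _ => fibreInner_self_nonneg _
  inner_self {f} := by
    rw [inner_def, MulOpposite.op_eq_zero_iff]
    refine ⟨fun h => ?_, fun h => by rw [h]; simp [innerₑ]⟩
    ext g
    by_cases hg : g ∈ f.support
    · exact fibreInner_self_eq_zero.mp
        ((Finset.sum_eq_zero_iff_of_nonneg fun g _ => fibreInner_self_nonneg _).mp h g hg)
    · exact notMem_support.mp hg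
  inner_op_smul_right {a f k} := by
    apply MulOpposite.unop_injective
    change innerₑ f (a • k) = innerₑ f k * a.unop
    rw [innerₑ_eq_sum_left fun g => notMem_support.mp,
      innerₑ_eq_sum_left fun g => notMem_support.mp, Finset.sum_mul]
    exact Finset.sum_congr rfl fun g _ => fibreInner_mul_right _ _ _
  inner_smul_right_complex {z f k} := by
    apply MulOpposite.unop_injective
    change innerₑ f (z • k) = z • innerₑ f k
    rw [innerₑ_eq_sum_left fun g => notMem_support.mp,
      innerₑ_eq_sum_left fun g => notMem_support.mp, Finset.smul_sum]
    exact Finset.sum_congr rfl fun g _ => fibreInner_smul_right _ _ _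
  star_inner f k := congrArg MulOpposite.op (star_innerₑ f k)
  norm_eq_sqrt_norm_inner_self _ := rfl

instance : NormedAddCommGroup B.Section := CStarModule.normedAddCommGroup (B.fibre 1)ᵐᵒᵖ

instance : NormedSpace ℂ B.Section := .ofCore (CStarModule.normedSpaceCore (B.fibre 1)ᵐᵒᵖ)

theorem norm_eq (f : B.Section) : ‖f‖ = √‖innerₑ f f‖ := rfl

instance : UniformContinuousConstSMul (B.fibre 1)ᵐᵒᵖ B.Section :=
  CStarModule.uniformContinuousConstSMul

end Section

/-- The right Hilbert `A_e`-module `ℓ²(A)`, the completion of `C_c(A)`. -/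
abbrev l2 : Type max u v := UniformSpace.Completion B.Section


/-! ### The regular representation -/

/-- An auxiliary fact on C⋆-algebras: if `0 ≤ p` and `‖p‖ ≤ t²` then `p = 2 t c - c²` for some
self-adjoint `c`. -/
theorem exists_isSelfAdjoint_sub_mul_self {A : Type*} [NonUnitalCStarAlgebra A] [PartialOrder A]
    [StarOrderedRing A] {p : A} (hp : 0 ≤ p) {t : ℝ} (ht : 0 ≤ t) (hpt : ‖p‖ ≤ t ^ 2) :
    ∃ c : A, star c = c ∧ (2 * t) • c - c * c = p := by
  have hsp : ∀ s ∈ quasispectrum ℝ p, s ≤ t ^ 2 := fun s hs =>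
    (le_abs_self s).trans ((NonUnitalIsometricContinuousFunctionalCalculus.norm_quasispectrum_le p hs
      (IsSelfAdjoint.of_nonneg hp)).trans hpt)
  refine ⟨cfcₙ (fun s : ℝ => t - √(t ^ 2 - s)) p, ?_, ?_⟩
  · exact (cfcₙ_predicate _ p : IsSelfAdjoint _).star_eq
  · have h0 : (fun s : ℝ => t - √(t ^ 2 - s)) 0 = 0 := by simp [Real.sqrt_sq ht]
    have hc : ContinuousOn (fun s : ℝ => t - √(t ^ 2 - s)) (quasispectrum ℝ p) := by fun_prop
    rw [← cfcₙ_mul _ _ p hc h0 hc h0, ← cfcₙ_smul (2 * t) _ p hc h0,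
      ← cfcₙ_sub _ _ p (by fun_prop) (by simp [Real.sqrt_sq ht]) (by fun_prop)
        (by simp [Real.sqrt_sq ht])]
    conv_rhs => rw [← cfcₙ_id' ℝ p]
    refine cfcₙ_congr fun s hs => ?_
    have := Real.sq_sqrt (sub_nonneg.mpr (hsp s hs))
    simp only [smul_eq_mul]
    nlinarith

variable {B} in
/-- `⟨a b, a b⟩ ≤ ‖a‖² ⟨b, b⟩`. -/
theorem fibreInner_mul_mul_le {g h k : G} (p : g * h = k) (a : B.fibre g) (b : B.fibre h) :
    fibreInner (B.mul p a b) (B.mul p a b) ≤ (‖a‖ ^ 2) • fibreInner b b := by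
  obtain ⟨c, hc, hcP⟩ := exists_isSelfAdjoint_sub_mul_self (fibreInner_self_nonneg a)
    (norm_nonneg a) (norm_fibreInner_self a).le
  have e1 : fibreInner (B.mul p a b) (B.mul p a b)
      = fibreInner b (B.mul (one_mul h) (fibreInner a a) b) := by
    subst p
    rw [fibreInner_mul_left rfl (by group) rfl]
    congr 1
    exact (B.mul_assoc _ _ _ _ _ _ _).symm
  set t : ℝ := ‖a‖
  set cb := B.mul (one_mul h) c b
  have e2 : fibreInner cb b = fibreInner b cb := by
    rw [fibreInner_mul_left (one_mul h) (one_mul h) inv_one c b b, adj_def, hc]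
  have e3 : fibreInner cb cb = fibreInner b (B.mul (one_mul h) (c * c) b) := by
    rw [fibreInner_mul_left (one_mul h) (one_mul h) inv_one c b cb, adj_def, hc]
    congr 1
    exact (B.mul_assoc _ _ _ _ _ _ _).symm
  have e4 : fibreInner b (B.mul (one_mul h) (fibreInner a a) b)
      = (2 * t) • fibreInner b cb - fibreInner cb cb := by
    have : fibreInner a a = ((2 * t : ℝ) : ℂ) • c + (-1 : ℂ) • (c * c) := by
      rw [← hcP, Complex.coe_smul]; module
    rw [e3, this, B.add_mul, B.smul_mul, B.smul_mul, fibreInner_add_right, fibreInner_smul_right,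
      fibreInner_smul_right, Complex.coe_smul]
    module
  have e5 := fibreInner_self_nonneg ((t : ℂ) • b + (-1 : ℂ) • cb)
  have e6 : fibreInner ((t : ℂ) • b + (-1 : ℂ) • cb) ((t : ℂ) • b + (-1 : ℂ) • cb)
      = (t ^ 2) • fibreInner b b - ((2 * t) • fibreInner b cb - fibreInner cb cb) := by
    have l : ∀ x : B.fibre h, fibreInner ((t : ℂ) • b + (-1 : ℂ) • cb) x
        = (t : ℂ) • fibreInner b x + (-1 : ℂ) • fibreInner cb x := fun x => by
      rw [← star_fibreInner, fibreInner_add_right, fibreInner_smul_right, fibreInner_smul_right,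
        star_add, star_smul, star_smul, star_fibreInner, star_fibreInner]
      simp
    rw [l, fibreInner_add_right, fibreInner_add_right, fibreInner_smul_right,
      fibreInner_smul_right, fibreInner_smul_right, fibreInner_smul_right, e2]
    generalize fibreInner b b = X
    generalize fibreInner b cb = Y
    generalize fibreInner cb cb = Z
    rw [Complex.coe_smul, Complex.coe_smul, Complex.coe_smul]
    module
  rw [e1, e4, ← sub_nonneg, ← e6]
  exact e5

namespace Section

variable {B}

/-- The operator `(λ_g(a) f)(h) = a f(g⁻¹ h)` on `C_c(A)`. -/
def translate {g : G} (a : B.fibre g) : B.Section →ₗ[ℂ] B.Section where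
  toFun f := DFinsupp.mapRange (fun h (x : B.fibre (g⁻¹ * h)) => B.mul (mul_inv_cancel_left g h) a x)
    (fun _ => mul_zero _ _)
    (DFinsupp.comapDomain' (fun h => g⁻¹ * h) (h' := fun k => g * k) (mul_inv_cancel_left g) f)
  map_add' _ _ := ext fun _ => B.mul_add _ _ _ _
  map_smul' _ _ := ext fun _ => B.mul_smul _ _ _ _

theorem translate_apply {g : G} (a : B.fibre g) (f : B.Section) (h : G) :
    translate a f h = B.mul (mul_inv_cancel_left g h) a (f (g⁻¹ * h)) := rfl

theorem mul_apply_congr {g h h' k : G} (p : g * h = k) (e : h = h') (a : B.fibre g)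
    (f : B.Section) : B.mul p a (f h) = B.mul (e ▸ p) a (f h') := by
  subst e; rfl

theorem innerₑ_translate_left {g g' : G} (r : g⁻¹ = g') (a : B.fibre g) (f k : B.Section) :
    innerₑ (translate a f) k = innerₑ f (translate (B.adj r a) k) := by
  subst r
  rw [innerₑ_eq_sum_left (s := f.support.map (mulLeftEmbedding g)),
    innerₑ_eq_sum_left fun g => notMem_support.mp, Finset.sum_map]
  · refine Finset.sum_congr rfl fun m _ => ?_
    change fibreInner (translate a f (g * m)) (k (g * m)) = _
    rw [translate_apply, translate_apply, mul_apply_congr _ (inv_mul_cancel_left g m),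
      mul_apply_congr _ (by rw [inv_inv] : g⁻¹⁻¹ * m = g * m)]
    exact fibreInner_mul_left _ _ _ _ _ _
  · intro h hh
    rw [translate_apply, notMem_support.mp, mul_zero]
    intro hm
    exact hh (Finset.mem_map.mpr ⟨_, hm, mul_inv_cancel_left g h⟩)

theorem norm_translate_le {g : G} (a : B.fibre g) (f : B.Section) :
    ‖translate a f‖ ≤ ‖a‖ * ‖f‖ := by
  have h1 : innerₑ (translate a f) (translate a f) ≤ (‖a‖ ^ 2) • innerₑ f f := by
    rw [innerₑ_eq_sum_left (s := f.support.map (mulLeftEmbedding g)),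
      innerₑ_eq_sum_left fun g => notMem_support.mp, Finset.sum_map, Finset.smul_sum]
    · refine Finset.sum_le_sum fun m _ => ?_
      change fibreInner (translate a f (g * m)) (translate a f (g * m)) ≤ _
      rw [translate_apply, mul_apply_congr _ (inv_mul_cancel_left g m)]
      exact fibreInner_mul_mul_le _ _ _
    · intro h hh
      rw [translate_apply, notMem_support.mp, mul_zero]
      intro hm
      exact hh (Finset.mem_map.mpr ⟨_, hm, mul_inv_cancel_left g h⟩)
  have h0 : 0 ≤ innerₑ (translate a f) (translate a f) :=
    Finset.sum_nonneg fun g _ => fibreInner_self_nonneg _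
  have h2 := CStarAlgebra.norm_le_norm_of_nonneg_of_le h0 h1
  rw [norm_smul, norm_pow, norm_norm] at h2
  rw [norm_eq, norm_eq, ← Real.sqrt_sq (norm_nonneg a), ← Real.sqrt_mul (sq_nonneg _)]
  exact Real.sqrt_le_sqrt h2

theorem translate_mul {g h k : G} (p : g * h = k) (a : B.fibre g) (b : B.fibre h)
    (f : B.Section) : translate (B.mul p a b) f = translate a (translate b f) := by
  subst p
  ext m
  simp only [translate_apply]
  rw [mul_apply_congr _ (by group : (g * h)⁻¹ * m = h⁻¹ * (g⁻¹ * m))]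
  exact B.mul_assoc _ _ _ _ _ _ _

/-- `λ_g(a)` as a bounded operator on `C_c(A)`. -/
def translateCLM {g : G} (a : B.fibre g) : B.Section →L[ℂ] B.Section :=
  (translate a).mkContinuous ‖a‖ (norm_translate_le a)

end Section

open UniformSpace


variable {B} in
/-- The continuous extension to `ℓ²(A)` of the operator `λ_g(a)` on `C_c(A)`. -/
def regularCLM {g : G} (a : B.fibre g) : B.l2 →L[ℂ] B.l2 :=
  (Completion.toComplL.comp (Section.translateCLM a)).extend Completion.toComplL

variable {B} in
theorem regularCLM_coe {g : G} (a : B.fibre g) (f : B.Section) :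
    regularCLM a (f : B.l2) = (Section.translate a f : B.Section) :=
  ContinuousLinearMap.extend_eq _ Completion.denseRange_coe
    (Completion.isUniformInducing_coe B.Section) f

variable {B} in
theorem inner_regularCLM {g g' : G} (r : g⁻¹ = g') (a : B.fibre g) (x y : B.l2) :
    inner (B.fibre 1)ᵐᵒᵖ (regularCLM a x) y =
      inner (B.fibre 1)ᵐᵒᵖ x (regularCLM (B.adj r a) y) :=
  Completion.induction_on₂ x y
    (isClosed_eq (((regularCLM a).continuous.comp continuous_fst).cstar_inner continuous_snd)
      (continuous_fst.cstar_inner ((regularCLM (B.adj r a)).continuous.comp continuous_snd)))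
    fun f k => by
      rw [regularCLM_coe, regularCLM_coe, CStarModule.completion_inner_coe,
        CStarModule.completion_inner_coe]
      exact congrArg MulOpposite.op (Section.innerₑ_translate_left r a f k)

/-- The C⋆-algebra `ℒ_{A_e}(ℓ²(A))` of adjointable operators on `ℓ²(A)`. -/
abbrev Operators : Type max u v := Adjointable (B.fibre 1)ᵐᵒᵖ B.l2

variable {B} in
theorem operators_ext {T S : B.Operators}
    (h : ∀ f : B.Section, T.toCLM (f : B.l2) = S.toCLM (f : B.l2)) : T = S :=
  Adjointable.toCLM_injective <| ContinuousLinearMap.ext fun x =>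
    Completion.induction_on x (isClosed_eq T.toCLM.continuous S.toCLM.continuous) h

/-- The left regular representation `λ_g : A_g → ℒ_{A_e}(ℓ²(A))`, determined by
`(λ_g(a) f)(h) = a f(g⁻¹ h)` for `f ∈ C_c(A)`. -/
def regular (g : G) : B.fibre g →ₗ[ℂ] B.Operators where
  toFun a := ⟨regularCLM a, regularCLM (B.adj rfl a), inner_regularCLM rfl a⟩
  map_add' a b := operators_ext fun f => by
    change regularCLM (a + b) (f : B.l2) = regularCLM a (f : B.l2) + regularCLM b (f : B.l2)
    rw [regularCLM_coe, regularCLM_coe, regularCLM_coe, ← Completion.coe_add]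
    congr 1
    exact Section.ext fun h => B.add_mul _ _ _ _
  map_smul' z a := operators_ext fun f => by
    change regularCLM (z • a) (f : B.l2) = z • regularCLM a (f : B.l2)
    rw [regularCLM_coe, regularCLM_coe, ← Completion.coe_smul]
    congr 1
    exact Section.ext fun h => B.smul_mul _ _ _ _

theorem regular_apply_coe (g : G) (a : B.fibre g) (f : B.Section) :
    (B.regular g a).toCLM (f : B.l2) = (Section.translate a f : B.Section) := regularCLM_coe a f

theorem regular_mul {g h : G} (a : B.fibre g) (b : B.fibre h) :
    B.regular g a * B.regular h b = B.regular (g * h) (B.mul rfl a b) :=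
  operators_ext fun f => by
    rw [Adjointable.toCLM_mul, regular_apply_coe, regular_apply_coe, regular_apply_coe,
      Section.translate_mul]

theorem star_regular {g : G} (a : B.fibre g) :
    star (B.regular g a) = B.regular g⁻¹ (B.adj rfl a) :=
  Adjointable.star_eq_of_inner (inner_regularCLM rfl a)

open Classical in
/-- The representation `ι(f) = ∑_g λ_g(f(g))` of `C_c(A)` on `ℓ²(A)`. -/
def rep : B.Section →ₗ[ℂ] B.Operators := DFinsupp.lsum ℂ B.regular

theorem rep_apply (f : B.Section) : B.rep f = ∑ g ∈ f.support, B.regular g (f g) := by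
  classical
  exact DFinsupp.sumAddHom_apply _ _

theorem rep_single (g : G) (a : B.fibre g) : B.rep (Section.single g a) = B.regular g a := by
  classical
  exact DFinsupp.lsum_single ℂ B.regular g a

/-! ### The reduced cross-sectional C⋆-algebra -/

/-- The C⋆-subalgebra of `ℒ_{A_e}(ℓ²(A))` generated by the operators `λ_g(a)`. -/
def reducedSubalgebra : NonUnitalStarSubalgebra ℂ B.Operators :=
  (NonUnitalStarAlgebra.adjoin ℂ
    {T | ∃ (g : G) (a : B.fibre g), T = B.regular g a}).topologicalClosure

/-- The reduced cross-sectional C⋆-algebra `C_r⋆(A)`. -/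
def Reduced : Type max u v := B.reducedSubalgebra

instance : NonUnitalCStarAlgebra B.Reduced :=
  NonUnitalStarSubalgebra.nonUnitalCStarAlgebra B.reducedSubalgebra
    (h_closed := NonUnitalStarSubalgebra.isClosed_topologicalClosure _)

/-- The order of the C⋆-algebra `C_r⋆(A)`. -/
instance : PartialOrder B.Reduced := CStarAlgebra.spectralOrder _

instance : StarOrderedRing B.Reduced := CStarAlgebra.spectralOrderedRing _

theorem regular_mem (g : G) (a : B.fibre g) : B.regular g a ∈ B.reducedSubalgebra :=
  NonUnitalStarSubalgebra.le_topologicalClosure _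
    (NonUnitalStarAlgebra.subset_adjoin ℂ _ ⟨g, a, rfl⟩)

theorem rep_mem (f : B.Section) : B.rep f ∈ B.reducedSubalgebra := by
  rw [rep_apply]
  exact sum_mem fun g _ => B.regular_mem g _

/-- The representation `ι` as a map into `C_r⋆(A)`. -/
def toReduced : B.Section →ₗ[ℂ] B.Reduced where
  toFun f := ⟨B.rep f, B.rep_mem f⟩
  map_add' f k := Subtype.ext (map_add B.rep f k)
  map_smul' z f := Subtype.ext (map_smul B.rep z f)

theorem norm_toReduced (f : B.Section) : ‖B.toReduced f‖ = ‖B.rep f‖ := rfl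

theorem denseRange_toReduced : DenseRange B.toReduced := by
  let S : Subsemigroup B.Operators :=
    { carrier := {T | ∃ (g : G) (a : B.fibre g), T = B.regular g a}
      mul_mem' := by
        rintro _ _ ⟨g, a, rfl⟩ ⟨h, b, rfl⟩
        exact ⟨_, _, B.regular_mul a b⟩ }
  have hS : Subsemigroup.closure ((S : Set B.Operators) ∪ star (S : Set B.Operators)) ≤ S := by
    rw [Subsemigroup.closure_le]
    rintro T (hT | ⟨g, a, hT⟩)
    · exact hT
    · exact ⟨_, _, by rw [← star_regular, ← hT, star_star]⟩
  have hle : ∀ T ∈ NonUnitalStarAlgebra.adjoin ℂ (S : Set B.Operators), ∃ f, B.rep f = T := by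
    intro T hT
    have h1 : T ∈ Submodule.span ℂ ((Subsemigroup.closure
        ((S : Set B.Operators) ∪ star (S : Set B.Operators)) : Subsemigroup _) :
          Set B.Operators) := by
      rw [← NonUnitalStarAlgebra.adjoin_eq_span]; exact hT
    have h2 : Submodule.span ℂ (S : Set B.Operators) ≤ LinearMap.range B.rep := by
      rw [Submodule.span_le]
      rintro _ ⟨g, a, rfl⟩
      exact ⟨_, B.rep_single g a⟩
    exact h2 (Submodule.span_mono hS h1)
  intro T
  refine Metric.mem_closure_iff.mpr fun ε hε => ?_
  obtain ⟨R, hR, hd⟩ := Metric.mem_closure_iff.mp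
    (show Subtype.val T ∈ closure _ from Subtype.property T) ε hε
  obtain ⟨f, rfl⟩ := hle R hR
  exact ⟨_, ⟨f, rfl⟩, hd⟩

/-! ### Bundle maps -/

/-- A `B`-bundle map: a family of bounded linear maps `T_g : B_g → B_g`. -/
abbrev BundleMap : Type max u v := ∀ g : G, B.fibre g →L[ℂ] B.fibre g

variable {B}

/-- The linear map `φ_T` on `C_c(B)` associated with a bundle map, `φ_T(f)(g) = T_g(f(g))`. -/
def BundleMap.onSections (T : B.BundleMap) : B.Section →ₗ[ℂ] B.Section :=
  DFinsupp.mapRange.linearMap fun g => (T g : B.fibre g →ₗ[ℂ] B.fibre g)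

theorem BundleMap.onSections_apply (T : B.BundleMap) (f : B.Section) (g : G) :
    T.onSections f g = T g (f g) := rfl

theorem BundleMap.onSections_single (T : B.BundleMap) (g : G) (a : B.fibre g) :
    T.onSections (Section.single g a) = Section.single g (T g a) := by
  classical
  exact DFinsupp.mapRange_single (hf := fun i => map_zero (T i))

/-- A bundle map `T` is reduced if `φ_T` is bounded with respect to the reduced norm
`‖f‖_r = ‖ι(f)‖` on `C_c(B)`. -/
def BundleMap.IsReduced (T : B.BundleMap) : Prop :=
  ∃ C : ℝ, ∀ f : B.Section, ‖B.rep (T.onSections f)‖ ≤ C * ‖B.rep f‖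

/-- The extension `M_T` of `φ_T` to a bounded linear map on `C_r⋆(B)`, for a reduced bundle map. -/
def BundleMap.IsReduced.extension {T : B.BundleMap} (_hT : T.IsReduced) :
    B.Reduced →L[ℂ] B.Reduced :=
  (B.toReduced ∘ₗ T.onSections).extendOfNorm B.toReduced

/-- `M_T` extends `φ_T`. -/
theorem BundleMap.IsReduced.extension_toReduced {T : B.BundleMap} (hT : T.IsReduced)
    (f : B.Section) : hT.extension (B.toReduced f) = B.toReduced (T.onSections f) :=
  LinearMap.extendOfNorm_eq (f := B.toReduced ∘ₗ T.onSections) B.denseRange_toReduced hT f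

/-- `M_T(λ_g(b)) = λ_g(T_g(b))`. -/
theorem BundleMap.IsReduced.extension_single {T : B.BundleMap} (hT : T.IsReduced)
    (g : G) (b : B.fibre g) :
    hT.extension (B.toReduced (Section.single g b)) = B.toReduced (Section.single g (T g b)) := by
  rw [hT.extension_toReduced, T.onSections_single]

variable (B)

/-- The bundle map `T^φ` with `T^φ_g(b) = φ(g) b` for `b ∈ B_g`. -/
def multiplier (φ : G → ℂ) : B.BundleMap := fun g => φ g • ContinuousLinearMap.id ℂ (B.fibre g)

end FellBundle

/-! ### Completely bounded maps -/

section CompletelyBounded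

variable {A B : Type*} [NonUnitalCStarAlgebra A] [PartialOrder A] [StarOrderedRing A]
  [NonUnitalCStarAlgebra B] [PartialOrder B] [StarOrderedRing B]

/-- The amplification `M_n(A) → M_n(B)` of a bounded linear map between C⋆-algebras, where the
matrix algebras carry their C⋆-norms. -/
def ContinuousLinearMap.amplification (M : A →L[ℂ] B) (n : ℕ) :
    CStarMatrix (Fin n) (Fin n) A →L[ℂ] CStarMatrix (Fin n) (Fin n) B where
  toLinearMap := CStarMatrix.mapₗ (M : A →ₗ[ℂ] B)
  cont := continuous_pi fun i => continuous_pi fun j =>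
    M.continuous.comp ((continuous_apply j).comp (continuous_apply i))

/-- A bounded linear map between C⋆-algebras is completely bounded if its amplifications are
uniformly bounded. -/
def ContinuousLinearMap.IsCompletelyBounded (M : A →L[ℂ] B) : Prop :=
  BddAbove (Set.range fun n : ℕ => ‖M.amplification n‖)

/-- The completely bounded norm `‖M‖_cb = sup_n ‖M_n‖`. -/
def ContinuousLinearMap.cbNorm (M : A →L[ℂ] B) : ℝ := ⨆ n : ℕ, ‖M.amplification n‖

end CompletelyBounded

end

/-! Since `v` is a representation, φ(hk⁻¹) = ⟨v(h)*ξ₁, v(k⁻¹)ξ₂⟩, so φ(hk⁻¹) = ⟨α(h), β(k)⟩ with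
‖α(h)‖ ≤ K‖ξ₁‖ and ‖β(k)‖ ≤ K‖ξ₂‖. Every such kernel is a completely bounded multiplier with
constant r·t, where r and t bound α and β (`norm_reducedMatrix_multiplier_le`); the two factors of K
come from the two bounds.

The mechanism is the usual factorization of a Schur multiplier. If φ(hk⁻¹) = ∑ₗ conj(aₗ(h)) bₗ(k),
then ⟨q, ι(φf)p⟩ = ∑ₗ ⟨aₗq, ι(f)(bₗp)⟩, where aₗq and bₗp are pointwise products
(`inner_rep_multiplier`). The right side is a coefficient of copies of ι(f) acting diagonally.
Cauchy–Schwarz bounds it by ‖ι(f)‖ times the norms of the families (aₗq) and (bₗp), which are at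
most r‖q‖ and t‖p‖ when ∑ₗ|aₗ|² ≤ r² and ∑ₗ|bₗ|² ≤ t² pointwise (`sum_inner_scale_le`). The same
computation works for matrices of sections.

The sum over l can be kept finite: q has finite support, so finitely many vectors α(h) matter. An
orthonormal basis of their span gives the coefficients, and Bessel's inequality gives the pointwise
bounds even though β(k) need not lie in the span (`exists_orthonormal_coordinates`).

Matrix norms over the reduced algebra are operator norms on ℓ²(B)^ι (`norm_matrixHom`), where they
are tested on finitely supported vectors. Matrices of size one show that the bundle map is reduced;
density of sections then extends the bound to every amplification. -/

noncomputable section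
open Filter Topology
set_option linter.unusedSectionVars false

/-! ### Operators on Hilbert C⋆-modules -/

section HilbertModule

variable {A E : Type*} [NonUnitalCStarAlgebra A] [PartialOrder A] [StarOrderedRing A]
  [NormedAddCommGroup E] [NormedSpace ℂ E] [SMul A E] [CStarModule A E]

open WithCStarModule

/-- The Cauchy–Schwarz inequality for finite families in a Hilbert C⋆-module. -/
theorem CStarModule.norm_sum_inner_le {κ : Type*} [Fintype κ] (x y : κ → E) :
    ‖∑ l, inner A (x l) (y l)‖ ≤ √‖∑ l, inner A (x l) (x l)‖ * √‖∑ l, inner A (y l) (y l)‖ :=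
  CStarModule.norm_inner_le (A := A) C⋆ᵐᵒᵈ(A, κ → E)
    (x := (equiv A (κ → E)).symm x) (y := (equiv A (κ → E)).symm y)

namespace Adjointable

/-- ‖T‖² - T*T is positive in the C⋆-algebra of adjointable operators, hence of the form S*S;
pairing with x exhibits the difference of the two sides as ⟨Sx, Sx⟩ ≥ 0. The inequality holds in A,
not merely in norm, so it can be summed over a family of vectors. -/
theorem inner_toCLM_self_le [CompleteSpace E] (T : Adjointable A E) (x : E) :
    inner A (T.toCLM x) (T.toCLM x) ≤ ‖T‖ ^ 2 • inner A x x := by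
  let _ : PartialOrder (Adjointable A E) := CStarAlgebra.spectralOrder _
  have _ : StarOrderedRing (Adjointable A E) := CStarAlgebra.spectralOrderedRing _
  have h := sub_nonneg.mpr (CStarAlgebra.star_mul_le_algebraMap_norm_sq (a := T))
  obtain ⟨S, hS⟩ := CStarAlgebra.nonneg_iff_eq_star_mul_self.mp h
  have h1 : inner A (S.toCLM x) (S.toCLM x) =
      ‖T‖ ^ 2 • inner A x x - inner A (T.toCLM x) (T.toCLM x) := by
    have h2 : star S * S + star T * T = ((‖T‖ ^ 2 : ℝ) : ℂ) • (1 : Adjointable A E) := by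
      rw [← hS, Complex.coe_smul, Algebra.algebraMap_eq_smul_one]; abel
    have h3 := congrArg (fun R : Adjointable A E => inner A x (R.toCLM x)) h2
    simp only [toCLM_add, toCLM_mul, toCLM_smul, CStarModule.inner_add_right, inner_star_right,
      CStarModule.inner_smul_right_complex] at h3
    rw [eq_sub_iff_add_eq, h3, Complex.coe_smul]
    rfl
  rw [← sub_nonneg, ← h1]
  exact CStarModule.inner_self_nonneg

/-- T acting diagonally on a finite direct sum has norm at most ‖T‖: the constant does not grow with
the number of summands. -/
theorem norm_sum_inner_toCLM_le [CompleteSpace E] {κ : Type*} [Fintype κ] (T : Adjointable A E)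
    (x y : κ → E) :
    ‖∑ l, inner A (x l) (T.toCLM (y l))‖ ≤
      ‖T‖ * √‖∑ l, inner A (x l) (x l)‖ * √‖∑ l, inner A (y l) (y l)‖ := by
  refine (CStarModule.norm_sum_inner_le _ _).trans ?_
  have h1 : ∑ l, inner A (T.toCLM (y l)) (T.toCLM (y l)) ≤ ‖T‖ ^ 2 • ∑ l, inner A (y l) (y l) := by
    rw [Finset.smul_sum]
    exact Finset.sum_le_sum fun l _ => T.inner_toCLM_self_le (y l)
  have h2 := CStarAlgebra.norm_le_norm_of_nonneg_of_le
    (Finset.sum_nonneg fun l _ => CStarModule.inner_self_nonneg) h1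
  rw [norm_smul, norm_pow, norm_norm] at h2
  have h3 : √‖∑ l, inner A (T.toCLM (y l)) (T.toCLM (y l))‖ ≤
      ‖T‖ * √‖∑ l, inner A (y l) (y l)‖ := by
    rw [← Real.sqrt_sq (norm_nonneg T), ← Real.sqrt_mul (sq_nonneg _)]
    exact Real.sqrt_le_sqrt h2
  calc _ ≤ √‖∑ l, inner A (x l) (x l)‖ * (‖T‖ * √‖∑ l, inner A (y l) (y l)‖) := by gcongr
    _ = _ := by ring

/-! ### Matrices of adjointable operators -/

variable {ι : Type*} [Fintype ι]

/-- The bounded operator on `E^ι` given by a matrix of bounded operators on `E`. -/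
def matrixCLM (X : ι → ι → E →L[ℂ] E) : C⋆ᵐᵒᵈ(A, ι → E) →L[ℂ] C⋆ᵐᵒᵈ(A, ι → E) :=
  (equivL ℂ (A := A) (E := ι → E)).symm.toContinuousLinearMap ∘L
    (ContinuousLinearMap.pi fun i => ∑ j, X i j ∘L ContinuousLinearMap.proj j) ∘L
      (equivL ℂ (A := A) (E := ι → E)).toContinuousLinearMap

theorem matrixCLM_apply (X : ι → ι → E →L[ℂ] E) (x : C⋆ᵐᵒᵈ(A, ι → E)) (i : ι) :
    matrixCLM X x i = ∑ j, X i j (x j) := by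
  change (∑ j, X i j ∘L ContinuousLinearMap.proj j) (equiv A (ι → E) x) = _
  rw [_root_.sum_apply]
  rfl

theorem inner_matrixCLM (X Y : ι → ι → E →L[ℂ] E)
    (h : ∀ i j (x y : E), inner A (X i j x) y = inner A x (Y j i y)) (x y : C⋆ᵐᵒᵈ(A, ι → E)) :
    inner A (matrixCLM X x) y = inner A x (matrixCLM Y y) := by
  simp only [pi_inner, matrixCLM_apply, CStarModule.inner_sum_left, CStarModule.inner_sum_right, h]
  exact Finset.sum_comm

variable {R : Type*} [NonUnitalCStarAlgebra R]

/-- The amplification to matrices of a representation on a Hilbert C⋆-module. -/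
def matrixHom (π : R →⋆ₙₐ[ℂ] Adjointable A E) :
    CStarMatrix ι ι R →⋆ₙₐ[ℂ] Adjointable A C⋆ᵐᵒᵈ(A, ι → E) where
  toFun X := ⟨matrixCLM fun i j => (π (X i j)).toCLM, matrixCLM fun i j => (π (star X i j)).toCLM,
    inner_matrixCLM _ _ fun i j x y => by
      rw [CStarMatrix.star_apply, map_star, inner_star_right]⟩
  map_smul' c X := toCLM_injective <| ContinuousLinearMap.ext fun x => by
    change matrixCLM _ x = c • matrixCLM _ x
    ext i
    simp [matrixCLM_apply, Finset.smul_sum]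
  map_zero' := toCLM_injective <| ContinuousLinearMap.ext fun x => by
    change matrixCLM _ x = 0
    ext i
    rw [matrixCLM_apply]
    refine Finset.sum_eq_zero fun j _ => ?_
    rw [CStarMatrix.zero_apply, map_zero]
    rfl
  map_add' X Y := toCLM_injective <| ContinuousLinearMap.ext fun x => by
    change matrixCLM _ x = matrixCLM _ x + matrixCLM _ x
    ext i
    simp [matrixCLM_apply, Finset.sum_add_distrib]
  map_mul' X Y := toCLM_injective <| ContinuousLinearMap.ext fun x => by
    change matrixCLM _ x = matrixCLM _ (matrixCLM _ x)
    ext i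
    -- The entries of XY are finite sums, so evaluation at a vector must be moved through them.
    have h (s : Finset ι) (F : ι → R) (y : E) :
        (π (∑ k ∈ s, F k)).toCLM y = ∑ k ∈ s, (π (F k)).toCLM y := by
      classical
      induction s using Finset.induction_on with
      | empty => simp only [Finset.sum_empty, map_zero]; rfl
      | insert a s ha ih => rw [Finset.sum_insert ha, Finset.sum_insert ha, map_add, toCLM_add, ih]
    simp only [matrixCLM_apply, CStarMatrix.mul_apply, h, map_mul, toCLM_mul]
    simp only [map_sum]
    exact Finset.sum_comm
  map_star' X := (star_eq_of_inner <| inner_matrixCLM _ _ fun i j x y => by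
      rw [CStarMatrix.star_apply, map_star, inner_star_right]).symm

theorem matrixHom_apply (π : R →⋆ₙₐ[ℂ] Adjointable A E) (X : CStarMatrix ι ι R)
    (x : C⋆ᵐᵒᵈ(A, ι → E)) (i : ι) :
    (matrixHom π X).toCLM x i = ∑ j, (π (X i j)).toCLM (x j) := matrixCLM_apply _ _ _

/-- Vectors concentrated in one coordinate recover the individual entries of the matrix. -/
theorem matrixHom_injective {π : R →⋆ₙₐ[ℂ] Adjointable A E} (hπ : Function.Injective π) :
    Function.Injective (matrixHom (ι := ι) π) := by
  classical
  intro X Y h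
  ext i j
  refine hπ (toCLM_injective (ContinuousLinearMap.ext fun x => ?_))
  have h1 := congrArg (fun T : Adjointable A C⋆ᵐᵒᵈ(A, ι → E) =>
    T.toCLM ((equiv A (ι → E)).symm (Pi.single j x)) i) h
  simp only [matrixHom_apply, equiv_symm_pi_apply] at h1
  rwa [Finset.sum_eq_single j (fun k _ hk => by rw [Pi.single_eq_of_ne hk, map_zero]) (by simp),
    Finset.sum_eq_single j (fun k _ hk => by rw [Pi.single_eq_of_ne hk, map_zero]) (by simp),
    Pi.single_eq_same] at h1

/-- An injective ⋆-homomorphism between C⋆-algebras is isometric, so the C⋆-norm of a matrix can be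
computed on E^ι for any faithful representation on E. -/
theorem norm_matrixHom [PartialOrder R] [StarOrderedRing R] [CompleteSpace E]
    {π : R →⋆ₙₐ[ℂ] Adjointable A E} (hπ : Function.Injective π) (X : CStarMatrix ι ι R) :
    ‖matrixHom π X‖ = ‖X‖ :=
  NonUnitalStarAlgHom.norm_map (matrixHom π) (matrixHom_injective hπ) X

/-- The norm of an adjointable operator may be tested on a dense set of vectors. -/
theorem norm_le_of_denseRange {X : Type*} {c : X → E} (hc : DenseRange c) (T : Adjointable A E)
    {C : ℝ} (hC : 0 ≤ C)
    (h : ∀ s t, ‖inner A (c s) (T.toCLM (c t))‖ ≤ C * ‖c s‖ * ‖c t‖) : ‖T‖ ≤ C := by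
  have h2 : ∀ x y : E, ‖inner A x (T.toCLM y)‖ ≤ C * ‖x‖ * ‖y‖ := by
    intro x y
    have hcont : Continuous fun p : E × E => inner A p.1 (T.toCLM p.2) :=
      (CStarModule.continuous_inner (A := A) (E := E)).comp
        (continuous_fst.prodMk (T.toCLM.continuous.comp continuous_snd))
    refine (hc.prodMap hc).induction_on (p := fun p : E × E =>
      ‖inner A p.1 (T.toCLM p.2)‖ ≤ C * ‖p.1‖ * ‖p.2‖) (x, y)
      (isClosed_le hcont.norm (by fun_prop)) fun p => h p.1 p.2
  refine ContinuousLinearMap.opNorm_le_bound _ hC fun x => ?_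
  change ‖T.toCLM x‖ ≤ _
  rcases (norm_nonneg (T.toCLM x)).eq_or_lt with h0 | h0
  · rw [← h0]; positivity
  · refine le_of_mul_le_mul_right ?_ h0
    -- Testing against Tx itself gives ‖Tx‖² ≤ C‖Tx‖‖x‖, from which one factor ‖Tx‖ is cancelled.
    have := h2 (T.toCLM x) x
    rw [← CStarModule.norm_sq_eq A] at this
    nlinarith

end Adjointable
end HilbertModule

universe u v

/-! ### Coefficients of finitely many vectors -/

/-- Finitely many inner products `⟪x, y⟫` with `x ∈ s` are computed by finitely many coordinates,
with Bessel's inequality for the coordinates. -/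
theorem exists_orthonormal_coordinates {H : Type*} [NormedAddCommGroup H] [InnerProductSpace ℂ H]
    (s : Finset H) : ∃ (d : ℕ) (e : Fin d → H),
      (∀ x ∈ s, ∀ y, inner ℂ x y = ∑ l, star (inner ℂ (e l) x) * inner ℂ (e l) y) ∧
        ∀ y, ∑ l, ‖inner ℂ (e l) y‖ ^ 2 ≤ ‖y‖ ^ 2 := by
  -- Expanding x in an orthonormal basis of U suffices: y may lie outside U, since only its
  -- coordinates along U pair with x.
  let U := Submodule.span ℂ (s : Set H)
  let b := stdOrthonormalBasis ℂ U
  have hb : Orthonormal ℂ fun l => (b l : H) := b.orthonormal.comp_linearIsometry U.subtypeₗᵢ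
  refine ⟨_, fun l => (b l : H), fun x hx y => ?_, fun y => hb.sum_inner_products_le y⟩
  have h := congrArg Subtype.val (b.sum_repr' ⟨x, Submodule.subset_span hx⟩)
  simp only [AddSubmonoidClass.coe_finsetSum, Submodule.coe_smul, Submodule.coe_inner] at h
  conv_lhs => rw [← h]
  rw [sum_inner]
  exact Finset.sum_congr rfl fun l _ => inner_smul_left _ _ _

namespace FellBundle

variable {G : Type u} [Group G] {B : FellBundle.{u, v} G}

/-! ### Multiplication by scalar functions -/

namespace Section

@[elab_as_elim]
theorem induction_linear {P : B.Section → Prop} (f : B.Section) (zero : P 0)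
    (add : ∀ f k, P f → P k → P (f + k)) (single : ∀ g x, P (single g x)) : P f := by
  classical
  exact DFinsupp.induction f zero fun g x k _ _ hk => add _ _ (single g x) hk

/-- The pointwise product of a scalar function and a section. -/
def scale (c : G → ℂ) : B.Section →ₗ[ℂ] B.Section := BundleMap.onSections (B.multiplier c)

@[simp] theorem scale_apply (c : G → ℂ) (f : B.Section) (g : G) : scale c f g = c g • f g := rfl

theorem fibreInner_smul_left {g : G} (z : ℂ) (a b : B.fibre g) :
    fibreInner (z • a) b = star z • fibreInner a b := by
  rw [← star_fibreInner, fibreInner_smul_right, star_smul, star_fibreInner]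

/-- The left side is ∑ₕ (∑ₗ |cₗ(h)|²) f(h)*f(h), a sum of positive elements with weights at most r².
-/
theorem sum_inner_scale_le {κ : Type*} [Fintype κ] {r : ℝ} (c : κ → G → ℂ)
    (hc : ∀ g, ∑ l, ‖c l g‖ ^ 2 ≤ r ^ 2) (f : B.Section) :
    ∑ l, inner (B.fibre 1)ᵐᵒᵖ (scale (c l) f) (scale (c l) f) ≤
      r ^ 2 • inner (B.fibre 1)ᵐᵒᵖ f f := by
  have h1 : ∑ l, innerₑ (scale (c l) f) (scale (c l) f) ≤ r ^ 2 • innerₑ f f := by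
    have h2 : ∀ l, innerₑ (scale (c l) f) (scale (c l) f) =
        ∑ h ∈ f.support, (‖c l h‖ ^ 2) • fibreInner (f h) (f h) := fun l => by
      rw [innerₑ_eq_sum_right (s := f.support) fun g hg => by
        rw [scale_apply, notMem_support.mp hg, smul_zero]]
      refine Finset.sum_congr rfl fun h _ => ?_
      rw [scale_apply, fibreInner_smul_left, fibreInner_smul_right, smul_smul, ← Complex.coe_smul]
      congr 1
      simpa using Complex.conj_mul' (c l h)
    simp_rw [h2]
    rw [Finset.sum_comm, innerₑ, Finset.smul_sum]
    refine Finset.sum_le_sum fun h _ => ?_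
    rw [← Finset.sum_smul]
    exact smul_le_smul_of_nonneg_right (hc h) (fibreInner_self_nonneg _)
  -- The module inner product takes values in the opposite algebra, so the inequality in the unit
  -- fibre is carried over.
  have h3 := MulOpposite.op_le_op.mpr h1
  rwa [Finset.op_sum, MulOpposite.op_smul] at h3

theorem innerₑ_translate (g : G) (a : B.fibre g) (q p : B.Section) :
    innerₑ q (translate a p) = ∑ h ∈ q.support,
      fibreInner (q h) (B.mul (mul_inv_cancel_left g h) a (p (g⁻¹ * h))) :=
  innerₑ_eq_sum_left fun _ => notMem_support.mp

end Section

open Section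

theorem coe_inner_regular (g : G) (a : B.fibre g) (q p : B.Section) :
    inner (B.fibre 1)ᵐᵒᵖ (q : B.l2) ((B.regular g a).toCLM (p : B.l2)) =
      MulOpposite.op (innerₑ q (translate a p)) := by
  rw [regular_apply_coe, CStarModule.completion_inner_coe]
  rfl

/-- A Schur multiplier identity: if `φ(h k⁻¹) = ∑ conj(a_l(h)) b_l(k)` on the support of `q`, the
matrix coefficients of `ι(φ f)` are sums of matrix coefficients of `ι(f)`. -/
theorem inner_rep_multiplier {κ : Type*} [Fintype κ] {φ : G → ℂ} {a b : κ → G → ℂ} {s : Finset G}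
    (h : ∀ h ∈ s, ∀ k, φ (h * k⁻¹) = ∑ l, star (a l h) * b l k)
    (f q p : B.Section) (hq : q.support ⊆ s) :
    inner (B.fibre 1)ᵐᵒᵖ (q : B.l2)
        ((B.rep ((B.multiplier φ).onSections f)).toCLM (p : B.l2)) =
      ∑ l, inner (B.fibre 1)ᵐᵒᵖ (scale (a l) q : B.l2)
        ((B.rep f).toCLM (scale (b l) p : B.Section)) := by
  induction f using Section.induction_linear with
  | zero =>
    have hz (x y : B.l2) : inner (B.fibre 1)ᵐᵒᵖ x ((0 : B.Operators).toCLM y) = 0 :=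
      CStarModule.inner_zero_right (A := (B.fibre 1)ᵐᵒᵖ) (E := B.l2)
    simp only [map_zero, hz, Finset.sum_const_zero]
  | add f k hf hk =>
    have ha (T S : B.Operators) (x y : B.l2) : inner (B.fibre 1)ᵐᵒᵖ x ((T + S).toCLM y) =
        inner (B.fibre 1)ᵐᵒᵖ x (T.toCLM y) + inner (B.fibre 1)ᵐᵒᵖ x (S.toCLM y) :=
      CStarModule.inner_add_right (A := (B.fibre 1)ᵐᵒᵖ) (E := B.l2)
    simp only [map_add, ha, hf, hk, Finset.sum_add_distrib]
  | single g x =>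
    simp only [BundleMap.onSections_single, rep_single, coe_inner_regular]
    rw [← Finset.op_sum]
    congr 1
    rw [innerₑ_translate]
    have h2 : ∀ l, innerₑ (scale (a l) q) (translate x (scale (b l) p)) = ∑ h ∈ q.support,
        (star (a l h) * b l (g⁻¹ * h)) •
          fibreInner (q h) (B.mul (mul_inv_cancel_left g h) x (p (g⁻¹ * h))) := fun l => by
      rw [innerₑ_eq_sum_left (s := q.support) fun g hg => by
        rw [scale_apply, notMem_support.mp hg, smul_zero]]
      refine Finset.sum_congr rfl fun h _ => ?_
      rw [scale_apply, Section.translate_apply, scale_apply, B.mul_smul, fibreInner_smul_left,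
        fibreInner_smul_right, smul_smul]
    simp_rw [h2]
    rw [Finset.sum_comm]
    refine Finset.sum_congr rfl fun m hm => ?_
    -- At the point m, the section p is evaluated at k = g⁻¹m. Since mk⁻¹ = g, the coefficients add
    -- up to φ(g), whatever m is.
    rw [← Finset.sum_smul, ← h m (hq hm)]
    change fibreInner _ (B.mul _ (φ g • x) _) = _
    rw [B.smul_mul, fibreInner_smul_right]
    congr 2
    group

/-! ### Complete boundedness -/

open WithCStarModule

/-- The inclusion of `C_r⋆(B)` into the adjointable operators on `ℓ²(B)`. -/
def reducedHom (B : FellBundle.{u, v} G) : B.Reduced →⋆ₙₐ[ℂ] B.Operators :=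
  NonUnitalStarSubalgebraClass.subtype B.reducedSubalgebra

theorem reducedHom_injective : Function.Injective B.reducedHom := Subtype.val_injective

variable {ι : Type*} [Fintype ι]

/-- A finite family of sections, as a vector of `ℓ²(B)^ι`. -/
def vector (p : ι → B.Section) : C⋆ᵐᵒᵈ((B.fibre 1)ᵐᵒᵖ, ι → B.l2) :=
  (equiv (B.fibre 1)ᵐᵒᵖ (ι → B.l2)).symm fun i => (p i : B.l2)

theorem denseRange_vector : DenseRange (vector : (ι → B.Section) → _) := by
  have h1 : DenseRange fun (p : ι → B.Section) i => (p i : B.l2) :=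
    DenseRange.piMap fun _ => UniformSpace.Completion.denseRange_coe
  have h2 := (equivL ℂ (A := (B.fibre 1)ᵐᵒᵖ) (E := ι → B.l2)).symm.surjective.denseRange
  exact h2.comp h1 (equivL ℂ (A := (B.fibre 1)ᵐᵒᵖ) (E := ι → B.l2)).symm.continuous

/-- The scalar weights act in the same way on each coordinate, so the estimate for one section adds
up over i, with the same constant r for every size of the family. -/
theorem sqrt_norm_sum_inner_scale_le {κ : Type*} [Fintype κ] {r : ℝ} (hr : 0 ≤ r) (c : κ → G → ℂ)
    (hc : ∀ g, ∑ l, ‖c l g‖ ^ 2 ≤ r ^ 2) (p : ι → B.Section) :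
    √‖∑ l, inner (B.fibre 1)ᵐᵒᵖ (vector fun i => scale (c l) (p i))
      (vector fun i => scale (c l) (p i))‖ ≤ r * ‖vector p‖ := by
  have e : ∀ u w : ι → B.Section, inner (B.fibre 1)ᵐᵒᵖ (vector u) (vector w) =
      ∑ i, inner (B.fibre 1)ᵐᵒᵖ (u i) (w i) := fun u w =>
    Finset.sum_congr rfl fun i _ => CStarModule.completion_inner_coe _ _
  have h1 : ∑ l, inner (B.fibre 1)ᵐᵒᵖ (vector fun i => scale (c l) (p i))
      (vector fun i => scale (c l) (p i)) ≤
        r ^ 2 • inner (B.fibre 1)ᵐᵒᵖ (vector p) (vector p) := by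
    simp only [e]
    rw [Finset.sum_comm, Finset.smul_sum]
    exact Finset.sum_le_sum fun i _ => sum_inner_scale_le c hc (p i)
  have h2 := CStarAlgebra.norm_le_norm_of_nonneg_of_le
    (Finset.sum_nonneg fun l _ => CStarModule.inner_self_nonneg) h1
  rw [norm_smul, ← CStarModule.norm_sq_eq (B.fibre 1)ᵐᵒᵖ, Real.norm_of_nonneg (sq_nonneg r),
    ← mul_pow] at h2
  exact Real.sqrt_le_iff.mpr ⟨by positivity, h2⟩

/-- The matrix with entries `ι(f_ij)` over `C_r⋆(B)`. -/
def reducedMatrix (f : ι → ι → B.Section) : CStarMatrix ι ι B.Reduced :=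
  CStarMatrix.ofMatrix fun i j => B.toReduced (f i j)

theorem inner_vector_reducedMatrix (f : ι → ι → B.Section) (q p : ι → B.Section) :
    inner (B.fibre 1)ᵐᵒᵖ (vector q)
        ((Adjointable.matrixHom B.reducedHom (reducedMatrix f)).toCLM (vector p)) =
      ∑ i, ∑ j, inner (B.fibre 1)ᵐᵒᵖ (q i : B.l2) ((B.rep (f i j)).toCLM (p j : B.l2)) := by
  rw [pi_inner]
  refine Finset.sum_congr rfl fun i _ => ?_
  rw [Adjointable.matrixHom_apply, CStarModule.inner_sum_right]
  rfl

/-- A scalar function of the form `φ(h k⁻¹) = ⟪α(h), β(k)⟫`, with `α` and `β` bounded functions into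
a Hilbert space, is a completely bounded multiplier. -/
theorem norm_reducedMatrix_multiplier_le {H : Type*} [NormedAddCommGroup H]
    [InnerProductSpace ℂ H] {φ : G → ℂ} {α β : G → H} {r t : ℝ} (hr : 0 ≤ r) (ht : 0 ≤ t)
    (hα : ∀ h, ‖α h‖ ≤ r) (hβ : ∀ k, ‖β k‖ ≤ t) (hφ : ∀ h k, φ (h * k⁻¹) = inner ℂ (α h) (β k))
    (f : ι → ι → B.Section) :
    ‖reducedMatrix fun i j => (B.multiplier φ).onSections (f i j)‖ ≤
      r * t * ‖reducedMatrix f‖ := by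
  classical
  rw [← Adjointable.norm_matrixHom reducedHom_injective,
    ← Adjointable.norm_matrixHom reducedHom_injective]
  refine Adjointable.norm_le_of_denseRange denseRange_vector _ (by positivity) fun q p => ?_
  let s : Finset G := Finset.univ.biUnion fun i => (q i).support
  -- The coefficients of the factorization are the coordinates of α and β along `e`. The dimension d
  -- depends on q, but the Bessel bounds do not depend on d.
  obtain ⟨d, e, he, hb⟩ := exists_orthonormal_coordinates (s.image α)
  have key : ∀ h ∈ s, ∀ k, φ (h * k⁻¹) =
      ∑ l, star (inner ℂ (e l) (α h)) * inner ℂ (e l) (β k) := fun h hh k => by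
    rw [hφ, he _ (Finset.mem_image_of_mem α hh)]
  have h1 : inner (B.fibre 1)ᵐᵒᵖ (vector q) ((Adjointable.matrixHom B.reducedHom
        (reducedMatrix fun i j => (B.multiplier φ).onSections (f i j))).toCLM (vector p)) =
      ∑ l, inner (B.fibre 1)ᵐᵒᵖ (vector fun i => scale (fun h => inner ℂ (e l) (α h)) (q i))
        ((Adjointable.matrixHom B.reducedHom (reducedMatrix f)).toCLM
          (vector fun i => scale (fun k => inner ℂ (e l) (β k)) (p i))) := by
    simp only [inner_vector_reducedMatrix]
    refine Eq.trans (Finset.sum_congr rfl fun i _ => ?_) Finset.sum_comm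
    refine Eq.trans (Finset.sum_congr rfl fun j _ => ?_) Finset.sum_comm
    exact inner_rep_multiplier key _ _ _
      (Finset.subset_biUnion_of_mem (fun i => (q i).support) (Finset.mem_univ i))
  have hA := sqrt_norm_sum_inner_scale_le hr (fun l h => inner ℂ (e l) (α h))
    (fun h => (hb (α h)).trans (by gcongr; exact hα h)) q
  have hB := sqrt_norm_sum_inner_scale_le ht (fun l k => inner ℂ (e l) (β k))
    (fun k => (hb (β k)).trans (by gcongr; exact hβ k)) p
  rw [h1]
  -- The matrix of `f` acts diagonally on d copies of the module, so d does not enter the bound.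
  refine (Adjointable.norm_sum_inner_toCLM_le _ _ _).trans ?_
  calc _ ≤ ‖Adjointable.matrixHom B.reducedHom (reducedMatrix f)‖ * (r * ‖vector q‖) *
        (t * ‖vector p‖) := by gcongr
    _ = _ := by ring

/-! ### From sections to the reduced C⋆-algebra -/

theorem denseRange_reducedMatrix :
    DenseRange (reducedMatrix : (ι → ι → B.Section) → CStarMatrix ι ι B.Reduced) :=
  DenseRange.piMap fun _ => DenseRange.piMap fun _ => B.denseRange_toReduced

theorem norm_reducedMatrix_const (f : B.Section) :
    ‖reducedMatrix fun _ _ : Unit => f‖ = ‖B.rep f‖ :=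
  NonUnitalStarAlgHom.norm_map (CStarMatrix.toOneByOne Unit ℂ B.Reduced)
    (CStarMatrix.toOneByOne Unit ℂ B.Reduced).injective (B.toReduced f)

/-- The reduced norm of a section is its norm as a 1 × 1 matrix, so reducedness is the size-one case
of the matrix estimate. -/
theorem isReduced_of_norm_reducedMatrix_le {T : B.BundleMap} {C : ℝ}
    (h : ∀ f : Unit → Unit → B.Section,
      ‖reducedMatrix fun i j => T.onSections (f i j)‖ ≤ C * ‖reducedMatrix f‖) : T.IsReduced :=
  ⟨C, fun f => by
    rw [← norm_reducedMatrix_const, ← norm_reducedMatrix_const]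
    exact h fun _ _ => f⟩

/-- Matrices of sections are dense and the amplification is continuous, so an estimate on sections
passes to all matrices over the reduced algebra. -/
theorem BundleMap.IsReduced.norm_amplification_le {T : B.BundleMap} (hT : T.IsReduced) {n : ℕ}
    {C : ℝ} (hC : 0 ≤ C) (h : ∀ f : Fin n → Fin n → B.Section,
      ‖reducedMatrix fun i j => T.onSections (f i j)‖ ≤ C * ‖reducedMatrix f‖) :
    ‖hT.extension.amplification n‖ ≤ C := by
  refine ContinuousLinearMap.opNorm_le_bound _ hC fun X => ?_
  refine denseRange_reducedMatrix.induction_on (p := fun X =>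
    ‖hT.extension.amplification n X‖ ≤ C * ‖X‖) X
    (isClosed_le (hT.extension.amplification n).continuous.norm
      (continuous_const.mul continuous_norm)) fun f => ?_
  have e : hT.extension.amplification n (reducedMatrix f) =
      reducedMatrix fun i j => T.onSections (f i j) := by
    ext i j
    exact hT.extension_toReduced (f i j)
  rw [e]
  exact h f

end FellBundle
end

/-! ### Coefficients of uniformly bounded representations -/

theorem proposition6p1 {G : Type*} [Group G] (B : FellBundle G)
    {H : Type*} [NormedAddCommGroup H] [InnerProductSpace ℂ H] [CompleteSpace H]
    (v : G →* (H →L[ℂ] H)ˣ)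
    (hv : BddAbove (Set.range fun g : G => ‖(v g : H →L[ℂ] H)‖)) (ξ₁ ξ₂ : H) :
    ∃ hT : (B.multiplier fun g : G => inner ℂ ξ₁ ((v g : H →L[ℂ] H) ξ₂)).IsReduced,
      hT.extension.IsCompletelyBounded ∧
        hT.extension.cbNorm ≤ (⨆ g : G, ‖(v g : H →L[ℂ] H)‖) ^ 2 * ‖ξ₁‖ * ‖ξ₂‖ := by
  set K := ⨆ g : G, ‖(v g : H →L[ℂ] H)‖ with hK
  have hle : ∀ g, ‖(v g : H →L[ℂ] H)‖ ≤ K := fun g => le_ciSup hv g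
  have hK0 : 0 ≤ K := (norm_nonneg _).trans (hle 1)
  -- The factorization uses α(h) = v(h)*ξ₁ and β(k) = v(k⁻¹)ξ₂. As `v` need not be unitary, v(k⁻¹)
  -- is not replaced by v(k)*.
  have hφ : ∀ h k : G, inner ℂ ξ₁ ((v (h * k⁻¹) : H →L[ℂ] H) ξ₂) =
      inner ℂ (ContinuousLinearMap.adjoint (v h : H →L[ℂ] H) ξ₁) ((v k⁻¹ : H →L[ℂ] H) ξ₂) :=
    fun h k => by
      rw [ContinuousLinearMap.adjoint_inner_left, map_mul]
      rfl
  have hα : ∀ h : G, ‖ContinuousLinearMap.adjoint (v h : H →L[ℂ] H) ξ₁‖ ≤ K * ‖ξ₁‖ := fun h =>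
    (ContinuousLinearMap.le_opNorm _ _).trans (by
      rw [LinearIsometryEquiv.norm_map]
      gcongr
      exact hle h)
  have hβ : ∀ k : G, ‖(v k⁻¹ : H →L[ℂ] H) ξ₂‖ ≤ K * ‖ξ₂‖ := fun k =>
    (ContinuousLinearMap.le_opNorm _ _).trans (by gcongr; exact hle _)
  have hT := FellBundle.isReduced_of_norm_reducedMatrix_le fun f =>
    FellBundle.norm_reducedMatrix_multiplier_le (B := B)
      (φ := fun g : G => inner ℂ ξ₁ ((v g : H →L[ℂ] H) ξ₂)) (by positivity) (by positivity) hα hβ hφ f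
  -- The constant (K‖ξ₁‖)(K‖ξ₂‖) is the same for every n.
  have hn : ∀ n, ‖hT.extension.amplification n‖ ≤ K ^ 2 * ‖ξ₁‖ * ‖ξ₂‖ := fun n => by
    refine (hT.norm_amplification_le (by positivity) fun f =>
      FellBundle.norm_reducedMatrix_multiplier_le (by positivity) (by positivity)
        hα hβ hφ f).trans_eq (by ring)
  exact ⟨hT, ⟨_, Set.forall_mem_range.mpr hn⟩, ciSup_le hn⟩
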